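/- Words are finite lists over an arbitrary set $\Sigma$; $\varepsilon$ is the empty word, $u\cdot v$ is concatenation, and $|u|$ is the length of $u$. A word is primitive if it is nonempty and not a power of a shorter word. Words $u,v$ are conjugate if $u=rq$ and $v=qr$ for some words $r,q$. A set $X$ of words is a code if distinct finite lists of elements of $X$ have distinct concatenations. $\langle X\rangle$ is the set of all concatenations of finite lists of elements of $X$. For a set $X$ of words, write $p\,u\,s\sim_{\mathcal I}\mathbf w$, and call it an $X$-interpretation of the word $u$, if $p,s$ are words, $\mathbf w$ is a nonempty finite list of elements of $X$, $p\cdot u\cdot s$ is the concatenation of $\mathbf w$, $p$ is a strict (that is, proper) prefix of the first entry of $\mathbf w$, and $s$ is a strict suffix of the last entry of $\mathbf w$. Here a strict prefix or suffix may be empty. If $u$ is the concatenation of a given list $\mathbf u$ of elements of $X$, the interpretation is disjoint (relative to $\mathbf u$) if, for every prefix $\mathbf w'$ of the list $\mathbf w$ and every prefix $\mathbf u'$ of the list $\mathbf u$ (the empty and the full lists included), the concatenation of $\mathbf w'$ differs from $p$ followed by the concatenation of $\mathbf u'$. It is extendable if $p$ is a suffix of some word of $\langle X\rangle$ and $s$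 is a prefix of some word of $\langle X\rangle$. **Theorem.** Let $\{x,y\}$ be a code of words over $\Sigma$ such that $|y|\le|x|$, both $x$ and $y$ are primitive, and $x$ and $y$ are not conjugate. Let $p\,(x\cdot x)\,s\sim_{\mathcal I}\mathbf w$ be an extendable $\{x,y\}$-interpretation of $x\cdot x$ that is disjoint relative to the factorization $[x,x]$. Then $$\mathbf w=[x,y,x],\qquad s\cdot p=y,\qquad p\cdot x=x\cdot s.$$ -/

import Mathlib

namespace CombinatoricsOnWords

variable {α : Type*}

/-- A word is primitive if it is nonempty and not a power of a shorter word. -/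
def Primitive (w : List α) : Prop :=
  w ≠ [] ∧ ∀ (v : List α) (k : ℕ), v.length < w.length → (List.replicate k v).flatten ≠ w

/-- Two words are conjugate if they have the form `r ++ q` and `q ++ r`. -/
def Conjugate (u v : List α) : Prop :=
  ∃ r q : List α, u = r ++ q ∧ v = q ++ r

/-- Conjugacy is the relation of being cyclic rotations of each other. -/
theorem conjugate_iff_isRotated {u v : List α} : Conjugate u v ↔ List.IsRotated u v := by
  constructor
  · rintro ⟨r, q, rfl, rfl⟩
    exact List.isRotated_append
  · intro h
    obtain ⟨n, hn, rfl⟩ := List.isRotated_iff_mod.1 h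
    exact ⟨u.take n, u.drop n, (List.take_append_drop n u).symm,
      List.rotate_eq_drop_append_take hn⟩

/-- The set of all words generated by `X`: concatenations of finite lists of elements of `X`. -/
def generated (X : Set (List α)) : Set (List α) :=
  {u : List α | ∃ L : List (List α), (∀ v ∈ L, v ∈ X) ∧ u = L.flatten}

/-- `IsInterpretation X p u s w` says that the triple `(p, s, w)` is an `X`-interpretation of the
word `u`: `w` is a nonempty list over `X`, `p u s` is the concatenation of `w`, `p` is a strict
prefix of the first entry of `w` and `s` is a strict suffix of the last entry of `w`. -/
structure IsInterpretation (X : Set (List α)) (p u s : List α) (w : List (List α)) : Prop where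
  mem : ∀ v ∈ w, v ∈ X
  ne_nil : w ≠ []
  concat_eq : p ++ u ++ s = w.flatten
  prefix_head : p <+: w.head ne_nil
  ne_head : p ≠ w.head ne_nil
  suffix_last : s <:+ w.getLast ne_nil
  ne_last : s ≠ w.getLast ne_nil

/-- An interpretation `(p, s, w)` of the word `U.flatten` is disjoint, relative to the
factorization `U`, if no prefix of `w` and prefix of `U` meet at a common boundary. -/
def IsDisjoint (p : List α) (U w : List (List α)) : Prop :=
  ∀ w' U' : List (List α), w' <+: w → U' <+: U → w'.flatten ≠ p ++ U'.flatten

/-- An `X`-interpretation `(p, s, w)` is extendable if `p` is a suffix, and `s` a prefix, of some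
words generated by `X`. -/
def IsExtendable (X : Set (List α)) (p s : List α) : Prop :=
  (∃ wp ∈ generated X, p <:+ wp) ∧ ∃ ws ∈ generated X, s <+: ws

end CombinatoricsOnWords

/-!
The proof compares the periods that an occurrence of `x x` in the concatenation of `w` imposes on
`x`, by means of the periodicity lemma of Fine and Wilf (`List.HasPeriod.gcd`).

A primitive word occurs in its square only trivially, so `x` is not an inner entry of `w`; hence
`w` is `a, y, …, y, b` with `a, b ∈ {x, y}`, and `p`, `s` are nonempty by disjointness. If `a` or
`b` is `y`, then a long factor of `x x` is a factor of a power of `y`. When it has length at least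
`|x| + |y|`, Fine and Wilf make `x` and `y` conjugate (`Primitive.conjugate_of_common_infix`).
Otherwise, up to reversal, `a = x` and `p` is shorter than `y`. Writing `x = p x' = x' p'`,
extendability says that `p` is a suffix of `x` or comparable with `y` as a suffix. The first is
impossible, since it gives `p = p'`, so that `p` commutes with `x'` although `x = p x'` is
primitive; a short suffix `p` of `y` leads to `p = p'` as well (`eq_of_suffix_of_overlap`).

There remains `p x x s = x y ^ k x`, where also `x = s' x'' = x'' s` and `p' s' = y ^ k`.

If `k ≥ 2`, then by the same arguments `p` ends with `y`, `s` starts with `y`, and `y x y` has both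
periods `|p|` and `|s|`, hence their greatest common divisor `g`. As `x` and `y` do not commute, `p`
and `s` are shorter than `|y| + g`; being multiples of `g` that are at least `|y|`, their lengths
are equal. So `y ^ k = p' p` with `p` and `p'` conjugate, say `p' = v u` and `p = u v`. For even `k`
both are powers of `y`. For odd `k = 2 m + 1` and `y = t t'` cut in the middle,
`v u = (t t') ^ m t` and `u v = (t' t) ^ m t'`, and periodicity forces `t = t'` (`eq_of_halves`).
In either case `p = p'`, a contradiction.

If `k = 1`, then `|p| + |s| = |y|`, extendability gives `y = s p`, and `p x = x s` follows once
`|p| = |s|`. If the lengths differ, `x` has the period `gcd |p| |s|`, and comparing `s p = p' s'`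
shows that `p = p'` or `s = s'` (`eq_of_hasPeriod_of_append_append`), again a contradiction.
-/

namespace CombinatoricsOnWords

open List

variable {α : Type*}

/-! ### Periods of words -/

theorem hasPeriod_of_prefix_append {u z : List α} (h : u <+: z ++ u) : HasPeriod u z.length := by
  rcases le_total u.length z.length with hl | hl
  · exact hasPeriod_of_length_le _ _ hl
  · have hz : z <+: u := prefix_of_prefix_length_le (prefix_append z u) h hl
    obtain ⟨v, rfl⟩ := hz
    simpa [HasPeriod] using h

/-- The converse of `hasPeriod_of_prefix_append` for words starting with `z`. -/
theorem prefix_of_hasPeriod_append {u z : List α} (h : HasPeriod (z ++ u) z.length) :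
    u <+: z ++ u := by
  simpa using h.drop_prefix

/-- A self-overlap `z ++ u = u ++ z'` propagates its period to both ends. -/
theorem hasPeriod_of_append_eq {u z z' : List α} (h : z ++ u = u ++ z') :
    HasPeriod (z ++ u ++ z') z.length :=
  hasPeriod_of_prefix_append (by
    rw [append_assoc, prefix_append_right_inj, ← append_assoc, h]
    exact ⟨z', rfl⟩)

/-- Two adjacent factors of length `n` in a word of period `n` are equal. -/
theorem eq_of_hasPeriod_append {u v : List α} {n : ℕ} (h : HasPeriod (u ++ v) n)
    (hu : u.length = n) (hv : v.length = n) : u = v := by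
  subst hu
  obtain ⟨r, hr⟩ := prefix_of_hasPeriod_append h
  exact (append_inj_left hr hv).symm

theorem getElem?_eq_of_modEq {w : List α} {n i j : ℕ} (h : HasPeriod w n)
    (hi : i < w.length) (hj : j < w.length) (hij : i ≡ j [MOD n]) : w[i]? = w[j]? := by
  rw [← h.getElem?_mod n i w hi, ← h.getElem?_mod n j w hj, hij]

theorem hasPeriod_reverse {w : List α} {n : ℕ} (h : HasPeriod w n) : HasPeriod w.reverse n := by
  rw [hasPeriod_iff_getElem?] at h ⊢
  intro i hi
  simp only [length_reverse] at hi
  rw [getElem?_reverse (by omega), getElem?_reverse (by omega),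
    h (w.length - 1 - (i + n)) (by omega)]
  congr 1
  omega

theorem exists_modEq_mem_window (i a : ℕ) {n : ℕ} (hn : 0 < n) :
    ∃ j, j < n ∧ a + j ≡ i [MOD n] := by
  refine ⟨(i + (n - 1) * a) % n, Nat.mod_lt _ hn, ?_⟩
  have h : a + (i + (n - 1) * a) = i + n * a := by
    obtain ⟨m, rfl⟩ : ∃ m, n = m + 1 := ⟨n - 1, by omega⟩
    simp only [Nat.add_sub_cancel]
    ring
  calc a + (i + (n - 1) * a) % n ≡ a + (i + (n - 1) * a) [MOD n] :=
        Nat.ModEq.add_left _ (Nat.mod_modEq _ _)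
    _ ≡ i [MOD n] := by rw [h]; simp [Nat.ModEq]

/-- If a factor covering a full period `n` of a word has a period `d` dividing `n`, then `d` is a
period of the whole word. -/
theorem hasPeriod_of_infix_of_dvd {U u : List α} {n d : ℕ} (hU : HasPeriod U n) (hinf : u <:+: U)
    (hu : HasPeriod u d) (hdvd : d ∣ n) (hn : 0 < n) (hle : n ≤ u.length) : HasPeriod U d := by
  obtain ⟨a, b, rfl⟩ := hinf
  rw [hasPeriod_iff_getElem?]
  intro i hi
  have key : ∀ j, j < u.length → (a ++ u ++ b)[a.length + j]? = u[j]? := by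
    intro j hj
    rw [append_assoc, getElem?_append_right (by omega), getElem?_append_left (by omega)]
    congr 1
    omega
  obtain ⟨j, hj, hji⟩ := exists_modEq_mem_window i a.length hn
  obtain ⟨j', hj', hji'⟩ := exists_modEq_mem_window (i + d) a.length hn
  have hlen : (a ++ u ++ b).length = a.length + u.length + b.length := by simp; omega
  rw [← getElem?_eq_of_modEq hU (by omega) (by omega) hji,
    ← getElem?_eq_of_modEq hU (by omega) (by omega) hji',
    key _ (by omega), key _ (by omega)]
  refine getElem?_eq_of_modEq hu (by omega) (by omega) (Nat.ModEq.add_left_cancel' a.length ?_)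
  calc a.length + j ≡ i [MOD d] := hji.of_dvd hdvd
    _ ≡ i + d [MOD d] := by simp [Nat.ModEq]
    _ ≡ a.length + j' [MOD d] := (hji'.of_dvd hdvd).symm

/-- The periodicity lemma applied to a factor, with the common period carried over to the whole
word. -/
theorem hasPeriod_gcd_of_infix {U u : List α} {n m : ℕ} (hU : HasPeriod U n) (hinf : u <:+: U)
    (hu : HasPeriod u m) (hn : 0 < n) (hm : 0 < m) (hle : n + m ≤ u.length + n.gcd m) :
    HasPeriod U (n.gcd m) := by
  have h1 := (hU.infix hinf).gcd hu (by omega)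
  have h2 := Nat.gcd_le_right n hm
  exact hasPeriod_of_infix_of_dvd hU hinf h1 (Nat.gcd_dvd_left _ _) hn (by omega)

/-- All factors of length `n` of a word of period `n` are conjugate. -/
theorem isRotated_take_of_infix {U z : List α} {n : ℕ} (hU : HasPeriod U n) (hinf : z <:+: U)
    (hz : z.length = n) : (U.take n) ~r z := by
  obtain ⟨a, b, rfl⟩ := hinf
  refine ⟨a.length, ?_⟩
  have hlen : ((a ++ z ++ b).take n).length = n := by simp; omega
  apply List.ext_getElem?
  intro i
  by_cases hi : i < n
  · rw [getElem?_rotate (by omega), hlen, getElem?_take_of_lt (Nat.mod_lt _ (by omega)),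
      hU.getElem?_mod _ _ _ (by simp; omega), append_assoc, getElem?_append_right (by omega),
      getElem?_append_left (by omega)]
    congr 1
    omega
  · rw [getElem?_eq_none (by rw [length_rotate]; omega), getElem?_eq_none (by omega)]

/-! ### Powers -/

/-- The power `y ^ n` of a word. -/
abbrev wordPow (y : List α) (n : ℕ) : List α := (replicate n y).flatten

theorem wordPow_succ (y : List α) (n : ℕ) : wordPow y (n + 1) = y ++ wordPow y n := by
  simp [wordPow, replicate_succ]

theorem wordPow_add (y : List α) (m n : ℕ) : wordPow y (m + n) = wordPow y m ++ wordPow y n := by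
  simp [wordPow, ← replicate_append_replicate]

theorem wordPow_succ' (y : List α) (n : ℕ) : wordPow y (n + 1) = wordPow y n ++ y := by
  rw [wordPow_add]; simp [wordPow]

theorem length_wordPow (y : List α) (n : ℕ) : (wordPow y n).length = n * y.length := by
  simp [wordPow]

theorem wordPow_append_comm (t t' : List α) (n : ℕ) :
    wordPow (t ++ t') n ++ t = t ++ wordPow (t' ++ t) n := by
  induction n with
  | zero => simp [wordPow]
  | succ n ih => rw [wordPow_succ, append_assoc, ih, wordPow_succ]; simp

theorem hasPeriod_wordPow (y : List α) (n : ℕ) : HasPeriod (wordPow y n) y.length :=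
  hasPeriod_of_prefix_append ⟨y, by rw [← wordPow_succ', wordPow_succ]⟩

theorem eq_wordPow_of_hasPeriod {d : ℕ} (k : ℕ) {w : List α} (h : HasPeriod w d)
    (hlen : w.length = k * d) : w = wordPow (w.take d) k := by
  induction k generalizing w with
  | zero => simpa [wordPow] using hlen
  | succ k ih =>
    have hlen' : (w.drop d).length = k * d := by
      rw [length_drop, hlen, Nat.succ_mul, Nat.add_sub_cancel]
    have hp := h.drop_prefix
    have := ih (h.infix hp.isInfix) hlen'
    rw [wordPow_succ]
    conv_lhs => rw [← take_append_drop d w, this]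
    rcases k with _ | k
    · simp [wordPow]
    · have hd : d ≤ (w.drop d).length := by rw [hlen']; exact Nat.le_mul_of_pos_left _ (by omega)
      rw [show (w.drop d).take d = w.take d by
        obtain ⟨r, hr⟩ := hp
        conv_rhs => rw [← hr, take_append_of_le_length hd]]

/-! ### Primitive words -/

theorem Primitive.length_pos {y : List α} (hy : Primitive y) : 0 < y.length :=
  length_pos_iff.2 hy.1

theorem Primitive.eq_length_of_hasPeriod {y : List α} (hy : Primitive y) {d : ℕ}
    (h : HasPeriod y d) (hd : d ∣ y.length) : d = y.length := by
  have hle := Nat.le_of_dvd hy.length_pos hd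
  by_contra hne
  obtain ⟨k, hk⟩ := hd
  exact hy.2 (y.take d) k (by simp; omega)
    (eq_wordPow_of_hasPeriod k h (by rw [hk, mul_comm])).symm

theorem Primitive.eq_nil_of_comm {u v : List α} (h : Primitive (u ++ v)) (hc : u ++ v = v ++ u) :
    u = [] ∨ v = [] := by
  by_contra! hne
  have hu := length_pos_iff.2 hne.1
  have hv := length_pos_iff.2 hne.2
  have h1 : HasPeriod (u ++ v) u.length := by
    apply hasPeriod_of_prefix_append
    rw [prefix_append_right_inj, hc]; exact prefix_append _ _
  have h2 : HasPeriod (u ++ v) v.length := by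
    rw [hc]; apply hasPeriod_of_prefix_append
    rw [prefix_append_right_inj, ← hc]; exact prefix_append _ _
  have h3 := h1.gcd h2 (by simp)
  have := h.eq_length_of_hasPeriod h3
    (by rw [length_append]; exact Nat.dvd_add (Nat.gcd_dvd_left _ _) (Nat.gcd_dvd_right _ _))
  have h4 := Nat.gcd_le_left v.length hu
  rw [length_append] at this
  omega

theorem Primitive.append_comm {u v : List α} (h : Primitive (u ++ v)) : Primitive (v ++ u) := by
  refine ⟨fun h0 => h.1 (by simp_all), fun z k hlt hz => ?_⟩
  have hper : HasPeriod (v ++ u) z.length := hz ▸ hasPeriod_wordPow z k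
  have hdvd : z.length ∣ (v ++ u).length := by
    rw [← hz, length_wordPow]; exact Dvd.intro_left _ rfl
  have hlen : (v ++ u).length = (u ++ v).length := by simp; omega
  have hU : HasPeriod (wordPow (u ++ v) 2) (v ++ u).length := by
    rw [hlen]; exact hasPeriod_wordPow _ _
  have hU' := hasPeriod_of_infix_of_dvd (u := v ++ u) hU ⟨u, v, by simp [wordPow]⟩ hper hdvd
    (hlen ▸ h.length_pos) le_rfl
  have := h.eq_length_of_hasPeriod (hU'.infix ⟨[], u ++ v, by simp [wordPow]⟩) (hlen ▸ hdvd)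
  omega

/-- In a word of period `|y|` containing the primitive word `y`, a period `m` of a factor that is
long enough for the periodicity lemma is a multiple of `|y|`. -/
theorem Primitive.length_dvd_of_infix {y U u : List α} {m : ℕ} (hy : Primitive y)
    (hU : HasPeriod U y.length) (hyU : y <:+: U) (hinf : u <:+: U) (hu : HasPeriod u m)
    (hm : 0 < m) (hle : y.length + m ≤ u.length + y.length.gcd m) : y.length ∣ m := by
  have h := hasPeriod_gcd_of_infix hU hinf hu hy.length_pos hm hle
  exact Nat.gcd_eq_left_iff_dvd.1
    (hy.eq_length_of_hasPeriod (h.infix hyU) (Nat.gcd_dvd_left _ _))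

/-- A common factor of length at least `|x| + |y|` of a word of period `|x|` and a word of period
`|y|` forces the primitive words `x` and `y` to be conjugate. -/
theorem Primitive.conjugate_of_common_infix {x y U V u : List α} (hx : Primitive x)
    (hy : Primitive y) (hU : HasPeriod U x.length) (hxU : x <:+: U) (hV : HasPeriod V y.length)
    (hyV : y <:+: V) (huU : u <:+: U) (huV : u <:+: V) (hle : x.length + y.length ≤ u.length) :
    Conjugate x y := by
  have h1 := hx.length_dvd_of_infix hU hxU huU (hV.infix huV) hy.length_pos (by omega)
  have h2 := hy.length_dvd_of_infix hV hyV huV (hU.infix huU) hx.length_pos (by omega)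
  have hxy := Nat.dvd_antisymm h1 h2
  have ht : u.take x.length <:+: u := (take_prefix _ _).isInfix
  have hl : (u.take x.length).length = x.length := by simp; omega
  rw [conjugate_iff_isRotated]
  have r1 := isRotated_take_of_infix hU hxU rfl
  have r2 := isRotated_take_of_infix hU (ht.trans huU) hl
  have r3 := isRotated_take_of_infix hV hyV rfl
  have r4 := isRotated_take_of_infix hV (ht.trans huV) (hl.trans hxy)
  exact (r1.symm.trans r2).trans (r4.symm.trans r3)

/-- A primitive word occurs in its square only as a prefix and as a suffix. -/
theorem Primitive.eq_nil_of_infix_square {x a b : List α} (hx : Primitive x)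
    (h : a ++ x ++ b = x ++ x) : a = [] ∨ b = [] := by
  have hl : a.length + b.length = x.length := by
    have := congrArg length h; simp at this; omega
  have ha : a <+: x := prefix_of_prefix_length_le (l₃ := x ++ x)
    ⟨x ++ b, by simpa using h⟩ (prefix_append _ _) (by omega)
  obtain ⟨c, rfl⟩ := ha
  simp only [append_assoc, append_cancel_left_eq] at h
  simp only [length_append] at hl
  have h' : (a ++ c) ++ b = (c ++ a) ++ c := by simpa using h
  obtain ⟨h1, rfl⟩ := append_inj h' (by simp; omega)
  exact hx.eq_nil_of_comm h1

/-! ### Overlaps of a short period with a power -/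

/-- By the period `|y|`, the prefix `p'` of `y` recurs after the first `|y|` letters of `p' q`. If `2|p| ≤ |y|`, the factor `p p'` lies inside `q`; otherwise
`p = e f`, `p' = f e` and `y = f e e`, where the border `f` of `y` forces the period `|e|`. -/
theorem eq_of_suffix_of_overlap {y p p' q : List α} (hlen : p.length = p'.length)
    (hlt : p.length < y.length) (hpy : p <:+ y) (hU : HasPeriod (p' ++ q) y.length)
    (hyU : y <+: p' ++ q) (hq : p <+: q) (hqper : HasPeriod q p.length)
    (hle : y.length ≤ q.length) : p = p' := by
  obtain ⟨g, rfl⟩ := hpy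
  obtain ⟨e, he⟩ : p' <+: g ++ p :=
    prefix_of_prefix_length_le (prefix_append p' q) hyU (by omega)
  obtain ⟨r, hr⟩ := hyU
  simp only [length_append] at *
  have hge : e.length = g.length := by
    have := congrArg length he; simp only [length_append] at this; omega
  -- the second copy of `y` starts with `p'` again
  have hp'r : p' <+: r := by
    have h1 : r <+: (g ++ p) ++ r := prefix_of_hasPeriod_append (by simpa [hr] using hU)
    have h2 : p' <+: (g ++ p) ++ r := ⟨q, hr.symm⟩
    refine prefix_of_prefix_length_le h2 h1 ?_
    have := congrArg length hr
    simp only [length_append] at this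
    omega
  have her : q = e ++ r := by
    rw [← he, append_assoc] at hr
    exact (append_cancel_left hr).symm
  obtain ⟨r', rfl⟩ := hp'r
  rcases le_or_gt p.length e.length with hpe | hpe
  · -- `y = p' m p`, and `q` contains `p p'`
    obtain ⟨m, hm⟩ : p <:+ e :=
      suffix_of_suffix_length_le (l₃ := g ++ p) (suffix_append _ _) ⟨p', he⟩ hpe
    refine eq_of_hasPeriod_append (hqper.infix ⟨m, r', ?_⟩) rfl hlen.symm
    rw [her, ← hm]; simp
  · obtain ⟨f, rfl⟩ : e <+: p :=
      prefix_of_prefix_length_le (l₃ := q) ⟨_, her.symm⟩ hq hpe.le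
    obtain ⟨c, rfl⟩ := hq
    simp only [length_append] at *
    -- the period of `q` turns `p = e f` into `p' = f e`
    have hp' : f ++ e = p' := by
      have hc : c <+: (e ++ f) ++ c := prefix_of_hasPeriod_append (by simpa using hqper)
      obtain ⟨c, rfl⟩ : e <+: c :=
        prefix_of_prefix_length_le (l₃ := (e ++ f) ++ c) ⟨_, her.symm⟩ hc (by omega)
      simp only [append_assoc, append_cancel_left_eq] at her
      rw [← append_assoc] at her
      exact append_inj_left her (by simp only [length_append]; omega)
    subst hp'
    -- `f` is a border of `y = f e e`, which yields the period `2|e|`; the factor `e e` refines it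
    have h2 : HasPeriod (g ++ (e ++ f)) (2 * e.length) := by
      have h := hasPeriod_of_append_eq (z := g ++ e) (u := f) (z' := e ++ e)
        (by simpa using he.symm)
      rw [length_append, ← hge, ← two_mul] at h
      exact h.infix ⟨[], e ++ e, by simp⟩
    have hee : HasPeriod (e ++ e) e.length := hasPeriod_of_prefix_append (by simp)
    have h1 : HasPeriod (g ++ (e ++ f)) g.length := hge ▸
      hasPeriod_of_infix_of_dvd h2 ⟨f, [], by simpa using he⟩ hee (Dvd.intro_left _ rfl)
        (by omega) (by simp; omega)
    obtain ⟨r, hr⟩ := prefix_of_hasPeriod_append h1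
    rw [← he] at hr
    exact append_inj_left hr (by simp only [length_append]; omega)

/-- The mirror image of `eq_of_suffix_of_overlap`. -/
theorem eq_of_prefix_of_overlap {y s s' q : List α} (hlen : s.length = s'.length)
    (hlt : s.length < y.length) (hsy : s <+: y) (hU : HasPeriod (q ++ s') y.length)
    (hyU : y <:+ q ++ s') (hq : s <:+ q) (hqper : HasPeriod q s.length)
    (hle : y.length ≤ q.length) : s = s' := by
  refine reverse_injective (eq_of_suffix_of_overlap (y := y.reverse) (q := q.reverse) ?_ ?_ ?_ ?_
    ?_ ?_ ?_ ?_)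
  · simpa
  · simpa
  · exact reverse_suffix.2 hsy
  · simpa using hasPeriod_reverse hU
  · simpa [← reverse_append, reverse_prefix] using hyU
  · exact reverse_prefix.2 hq
  · simpa using hasPeriod_reverse hqper
  · simpa

/-! ### Conjugate halves of a power -/

/-- If `v u` and `u v` are the two halves of an odd power of `t t'`, where `t` and `t'` have equal
lengths, and `|u|` covers the primitive word `t t'`, then `t = t'`. -/
theorem eq_of_halves_of_le {t t' u v : List α} {m : ℕ} (hprim : Primitive (t ++ t'))
    (hlen : t.length = t'.length) (hvu : v ++ u = wordPow (t ++ t') m ++ t)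
    (huv : u ++ v = wordPow (t' ++ t) m ++ t') (hle : (t ++ t').length ≤ u.length) : t = t' := by
  have hU : v ++ u ++ (u ++ v) = wordPow (t ++ t') (m + (1 + m)) := by
    rw [hvu, huv, wordPow_add, wordPow_add, append_assoc, wordPow_append_comm t' t,
      append_cancel_left_eq]
    simp [wordPow]
  have hy := hprim.length_pos
  have hper := hU ▸ hasPeriod_wordPow (t ++ t') (m + (1 + m))
  -- the square `u u` has periods `|u|` and `|t t'|`, hence `|t t'|` divides `|u|`
  obtain ⟨a, ha⟩ : (t ++ t').length ∣ u.length := by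
    refine hprim.length_dvd_of_infix (u := u ++ u) hper ?_ ⟨v, v, by simp⟩
      (hasPeriod_of_prefix_append (by simp)) (by omega) (by simp only [length_append] at *; omega)
    rw [hU, add_comm, add_assoc, wordPow_add]
    exact ⟨[], wordPow (t ++ t') (m + m), by simp [wordPow]⟩
  have ham : a ≤ m := by
    have h := congrArg length huv
    rw [length_append, length_append, length_wordPow, ha] at h
    simp only [length_append] at *
    by_contra! hlt
    have := Nat.mul_le_mul_right (t.length + t'.length) (Nat.succ_le_of_lt hlt)
    rw [Nat.succ_mul, mul_comm a] at this
    rw [add_comm t'.length] at h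
    omega
  obtain ⟨b, rfl⟩ := Nat.exists_eq_add_of_le ham
  -- cancelling `u` exhibits `v` as `(t' t) ^ b t'`, while `v u` starts with `t`
  have hv : v = wordPow (t' ++ t) b ++ t' := by
    rw [wordPow_add, append_assoc] at huv
    refine append_inj_right huv ?_
    rw [length_wordPow, ha, length_append, length_append, mul_comm, add_comm t.length]
  have ht : t <+: v ++ u := by
    rw [hvu, wordPow_append_comm]; exact prefix_append _ _
  have ht' : t' <+: v ++ u := by
    rw [hv, wordPow_append_comm, append_assoc]; exact prefix_append _ _
  obtain ⟨r, hr⟩ := prefix_of_prefix_length_le ht ht' hlen.le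
  have hr0 : r = [] := by
    rw [← length_eq_zero_iff]
    have := congrArg length hr
    simp only [length_append] at this
    omega
  simpa [hr0] using hr

/-- The case not covered by `eq_of_halves_of_le`, in which both `u` and `v` are shorter than `t t'`,
has `m = 1` and contradicts the primitivity of `t t'`. -/
theorem eq_of_halves {t t' u v : List α} {m : ℕ} (hprim : Primitive (t ++ t'))
    (hlen : t.length = t'.length) (hvu : v ++ u = wordPow (t ++ t') m ++ t)
    (huv : u ++ v = wordPow (t' ++ t) m ++ t') (hm : 0 < m) : t = t' := by
  rcases le_or_gt (t ++ t').length u.length with hu | hu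
  · exact eq_of_halves_of_le hprim hlen hvu huv hu
  rcases le_or_gt (t' ++ t).length v.length with hv | hv
  · exact (eq_of_halves_of_le hprim.append_comm hlen.symm huv hvu hv).symm
  obtain ⟨m, rfl⟩ : ∃ k, m = k + 1 := ⟨m - 1, by omega⟩
  have hl := congrArg length hvu
  rw [length_append, length_append, length_wordPow, Nat.succ_mul] at hl
  simp only [length_append] at hl hu hv
  obtain rfl : m = 0 := by
    by_contra h0
    have := Nat.le_mul_of_pos_left (t.length + t'.length) (Nat.pos_of_ne_zero h0)
    omega
  simp only [wordPow, zero_add, replicate_one, flatten_cons, flatten_nil, append_nil,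
    zero_mul] at hvu huv hl
  -- `v` is a border of `t t'` and `u` is a border of `t' t`
  obtain ⟨c, hc⟩ : v <+: t ++ t' := prefix_of_prefix_length_le (l₃ := v ++ u)
    (prefix_append _ _) (hvu ▸ prefix_append _ _) (by simp; omega)
  obtain ⟨c', hc'⟩ : v <:+ t ++ t' := suffix_of_suffix_length_le (l₃ := u ++ v)
    (suffix_append _ _) ⟨t', by rw [huv, append_assoc]⟩ (by simp; omega)
  obtain ⟨d, hd⟩ : u <+: t' ++ t := prefix_of_prefix_length_le (l₃ := u ++ v)
    (prefix_append _ _) (huv ▸ prefix_append _ _) (by simp; omega)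
  obtain ⟨d', hd'⟩ : u <:+ t' ++ t := suffix_of_suffix_length_le (l₃ := v ++ u)
    (suffix_append _ _) ⟨t, by rw [hvu, append_assoc]⟩ (by simp; omega)
  have hcl := congrArg length hc'
  have hdl := congrArg length hd'
  simp only [length_append] at hcl hdl
  have hpt : HasPeriod (t ++ t') c'.length :=
    hc' ▸ (hasPeriod_of_append_eq (hc'.trans hc.symm)).infix ⟨[], c, rfl⟩
  have hpt' : HasPeriod (t' ++ t) d'.length :=
    hd' ▸ (hasPeriod_of_append_eq (hd'.trans hd.symm)).infix ⟨[], d, rfl⟩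
  -- the two periods sum up to `|t|`, so that `t t'` has their greatest common divisor as a period
  have hsum : c'.length + d'.length = t.length := by omega
  have hg := hasPeriod_gcd_of_infix hpt ⟨[], t', rfl⟩ (hpt'.infix ⟨t', [], by simp⟩)
    (by omega) (by omega) (by omega)
  have hdvd : c'.length.gcd d'.length ∣ (t ++ t').length := by
    have : c'.length.gcd d'.length ∣ t.length :=
      hsum ▸ Nat.dvd_add (Nat.gcd_dvd_left _ _) (Nat.gcd_dvd_right _ _)
    rw [length_append, ← hlen]
    exact Nat.dvd_add this this
  have := hprim.eq_length_of_hasPeriod hg hdvd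
  have := Nat.gcd_le_left d'.length (m := c'.length) (by omega)
  simp only [length_append] at *
  omega

/-- For even `k` both words equal `y ^ (k / 2)`; for odd `k` the middle of `y ^ k` cuts a copy of
`y` into halves, to which `eq_of_halves` applies. -/
theorem Primitive.eq_of_isRotated_of_append_eq_wordPow {y p p' : List α} {k : ℕ}
    (hy : Primitive y) (hrot : p' ~r p) (h : p' ++ p = wordPow y k) (hk : 2 ≤ k) : p = p' := by
  have hlen := hrot.perm.length_eq
  obtain ⟨m, rfl | rfl⟩ := Nat.even_or_odd' k
  · rw [two_mul, wordPow_add] at h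
    have hl := congrArg length h
    simp only [length_append] at hl
    obtain ⟨h1, h2⟩ := append_inj h (by omega)
    exact h2.trans h1.symm
  · have hl := congrArg length h
    rw [length_append, length_wordPow, hlen] at hl
    have hpl : 2 * (p.length - m * y.length) = y.length ∧ m * y.length ≤ p.length := by
      have : (2 * m + 1) * y.length = 2 * (m * y.length) + y.length := by ring
      omega
    have hh : p.length - m * y.length ≤ y.length := by omega
    set t := y.take (p.length - m * y.length) with ht
    set t' := y.drop (p.length - m * y.length) with ht'
    have htt : y = t ++ t' := (take_append_drop _ _).symm
    have htl : t.length = p.length - m * y.length := by simp [ht]; omega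
    have htl' : t'.length = p.length - m * y.length := by simp [ht']; omega
    have hsplit : p' ++ p = (wordPow (t ++ t') m ++ t) ++ (wordPow (t' ++ t) m ++ t') := by
      rw [h, show 2 * m + 1 = m + (1 + m) by ring, wordPow_add, wordPow_add, append_assoc,
        wordPow_append_comm t' t, ← htt]
      simp [wordPow, htt]
    obtain ⟨h1, h2⟩ := append_inj hsplit (by rw [length_append, length_wordPow, ← htt]; omega)
    obtain ⟨v, u, hv, hu⟩ := conjugate_iff_isRotated.2 hrot
    have hprim := htt ▸ hy
    have := eq_of_halves (m := m) hprim (htl.trans htl'.symm) (hv ▸ h1) (hu ▸ h2) (by omega)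
    rw [h1, h2, this]

/-! ### Consequences of extendability -/

/-- Both `p` and the last factor of a word of `⟨x, y⟩` ending with `p` are suffixes of that word,
hence comparable. -/
theorem suffix_trichotomy {x y p : List α} (hpx : p.length ≤ x.length) (hp : p ≠ [])
    (hext : ∃ wp ∈ generated {x, y}, p <:+ wp) : p <:+ x ∨ p <:+ y ∨ y <:+ p := by
  obtain ⟨_, ⟨L, hL, rfl⟩, h⟩ := hext
  rcases eq_nil_or_concat L with rfl | ⟨L, z, rfl⟩
  · exact absurd (by simpa using h) hp
  have hz : z <:+ (L.concat z).flatten := ⟨L.flatten, by simp⟩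
  rcases hL z (by simp) with rfl | rfl
  · exact Or.inl (suffix_of_suffix_length_le h hz hpx)
  · exact Or.inr (suffix_or_suffix_of_suffix h hz)

theorem prefix_trichotomy {x y s : List α} (hsx : s.length ≤ x.length) (hs : s ≠ [])
    (hext : ∃ ws ∈ generated {x, y}, s <+: ws) : s <+: x ∨ s <+: y ∨ y <+: s := by
  obtain ⟨_, ⟨L, hL, rfl⟩, h⟩ := hext
  rcases L with _ | ⟨z, L⟩
  · exact absurd (by simpa using h) hs
  have hz : z <+: (z :: L).flatten := ⟨L.flatten, by simp⟩
  rcases hL z (by simp) with rfl | rfl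
  · exact Or.inl (prefix_of_prefix_length_le h hz hsx)
  · exact Or.inr (prefix_or_prefix_of_prefix h hz)

/-- The overlap words of a primitive word with itself on its two ends are distinct. -/
theorem Primitive.ne_of_overlap {x p p' x' : List α} (hx : Primitive x) (h1 : x = p ++ x')
    (h2 : x = x' ++ p') (hp : p ≠ []) (hx' : x' ≠ []) : p ≠ p' := by
  rintro rfl
  rcases (h1 ▸ hx).eq_nil_of_comm (h1.symm.trans h2) with h | h
  · exact hp h
  · exact hx' h

theorem length_eq_of_overlap {x p p' x' : List α} (h1 : x = p ++ x') (h2 : x = x' ++ p') :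
    p.length = p'.length := by
  have := congrArg length (h1.symm.trans h2)
  simp only [length_append] at this
  omega

theorem Primitive.not_suffix_of_overlap {x p p' x' : List α} (hx : Primitive x) (h1 : x = p ++ x')
    (h2 : x = x' ++ p') (hp : p ≠ []) (hx' : x' ≠ []) : ¬ p <:+ x := fun h =>
  have hlen := length_eq_of_overlap h1 h2
  hx.ne_of_overlap h1 h2 hp hx'
    ((suffix_of_suffix_length_le h ⟨x', h2.symm⟩ hlen.le).eq_of_length hlen)

theorem Primitive.not_prefix_of_overlap {x s s' x'' : List α} (hx : Primitive x) (h1 : x = x'' ++ s)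
    (h2 : x = s' ++ x'') (hs : s ≠ []) (hx'' : x'' ≠ []) : ¬ s <+: x := fun h =>
  have hlen := length_eq_of_overlap h2 h1
  hx.ne_of_overlap h2 h1 (fun h0 => hs (by simpa [h0, eq_comm] using hlen)) hx''
    ((prefix_of_prefix_length_le h ⟨x'', h2.symm⟩ hlen.ge).eq_of_length hlen.symm).symm

/-- The left overlap word `p` of a primitive word `x` is not a suffix of `x`; if extendability makes
it comparable with `y` instead, then it ends with `y`, short words being excluded by the last
hypothesis. -/
theorem Primitive.suffix_of_overlap {x y p p' x' : List α} (hx : Primitive x) (h1 : x = p ++ x')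
    (h2 : x = x' ++ p') (hp : p ≠ []) (hx' : x' ≠ [])
    (htri : p <:+ x ∨ p <:+ y ∨ y <:+ p)
    (hshort : p <:+ y → p.length < y.length → p = p') : y <:+ p := by
  rcases htri with h | h | h
  · exact absurd h (hx.not_suffix_of_overlap h1 h2 hp hx')
  · rcases h.length_le.lt_or_eq with hlt | heq
    · exact absurd (hshort h hlt) (hx.ne_of_overlap h1 h2 hp hx')
    · rw [h.eq_of_length heq]
  · exact h

/-- The mirror image of `Primitive.suffix_of_overlap`. -/
theorem Primitive.prefix_of_overlap {x y s s' x'' : List α} (hx : Primitive x) (h1 : x = x'' ++ s)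
    (h2 : x = s' ++ x'') (hs : s ≠ []) (hx'' : x'' ≠ [])
    (htri : s <+: x ∨ s <+: y ∨ y <+: s)
    (hshort : s <+: y → s.length < y.length → s = s') : y <+: s := by
  rcases htri with h | h | h
  · exact absurd h (hx.not_prefix_of_overlap h1 h2 hs hx'')
  · rcases h.length_le.lt_or_eq with hlt | heq
    · exact absurd ⟨x'', hshort h hlt ▸ h2.symm⟩ (hx.not_prefix_of_overlap h1 h2 hs hx'')
    · rw [h.eq_of_length heq]
  · exact h

/-! ### Interpretations by both words -/

theorem prefix_wordPow (y : List α) {n : ℕ} (hn : 0 < n) : y <+: wordPow y n := by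
  obtain ⟨m, rfl⟩ : ∃ m, n = m + 1 := ⟨n - 1, by omega⟩
  exact ⟨wordPow y m, (wordPow_succ y m).symm⟩

theorem suffix_wordPow (y : List α) {n : ℕ} (hn : 0 < n) : y <:+ wordPow y n := by
  obtain ⟨m, rfl⟩ : ∃ m, n = m + 1 := ⟨n - 1, by omega⟩
  exact ⟨wordPow y m, (wordPow_succ' y m).symm⟩

theorem pos_of_ne_nil_of_eq_wordPow {u y : List α} {n : ℕ} (h : u = wordPow y n) (hu : u ≠ []) :
    0 < n := by
  rcases n with _ | n
  · exact absurd (by simpa [wordPow] using h) hu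
  · omega

/-- The square `x x` is not a factor of a power of `y`. -/
theorem not_append_square_append_eq_wordPow {x y p s : List α} {n : ℕ} (hx : Primitive x)
    (hy : Primitive y) (hconj : ¬ Conjugate x y) (hle : y.length ≤ x.length) :
    p ++ (x ++ x) ++ s ≠ wordPow y n := by
  intro h
  have hn := pos_of_ne_nil_of_eq_wordPow h (by simp [hx.1])
  refine hconj (hx.conjugate_of_common_infix (U := x ++ x) (u := x ++ x) (V := wordPow y n) hy
    (hasPeriod_of_prefix_append (by simp)) ⟨[], x, rfl⟩ (hasPeriod_wordPow y n)
    (prefix_wordPow y hn).isInfix (infix_refl _) ⟨p, s, h⟩ ?_)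
  rw [length_append]; omega

/-- No extendable interpretation of `x x` has only its first entry equal to `x`. -/
theorem append_power_ne {x y p s : List α} {n : ℕ} (hx : Primitive x)
    (hy : Primitive y) (hconj : ¬ Conjugate x y) (hle : y.length ≤ x.length)
    (hp : p ≠ []) (hpx : p <+: x) (hpne : p ≠ x) (htri : p <:+ x ∨ p <:+ y ∨ y <:+ p) :
    p ++ (x ++ x) ++ s ≠ x ++ wordPow y n := by
  intro h
  obtain ⟨x', h1⟩ := hpx
  have hx' : x' ≠ [] := by rintro rfl; exact hpne (by simpa using h1)
  have hpl := length_pos_iff.2 hp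
  have h' : x' ++ wordPow y n = x ++ (x ++ s) := by
    have h0 := h
    nth_rewrite 3 [← h1] at h0
    simpa using h0.symm
  obtain ⟨p', h2⟩ : x' <+: x := prefix_of_prefix_length_le (l₃ := x' ++ wordPow y n)
    (prefix_append _ _) (h' ▸ prefix_append _ _) (by rw [← h1]; simp)
  have hpow : p' ++ x ++ s = wordPow y n := by
    nth_rewrite 1 [← h2] at h'
    simpa using h'.symm
  have hlen : p.length = p'.length := by
    have := congrArg length (h1.trans h2.symm)
    simp only [length_append] at this
    omega
  have hn := pos_of_ne_nil_of_eq_wordPow hpow (by simp [hx.1])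
  have hper : HasPeriod (p' ++ x) y.length :=
    (hasPeriod_wordPow y n).infix ⟨[], s, by simpa using hpow⟩
  have hyp : y <+: p' ++ x := prefix_of_prefix_length_le (prefix_wordPow y hn)
    ⟨s, hpow⟩ (by simp; omega)
  have hxper : HasPeriod x p.length := by
    refine (hasPeriod_of_append_eq (z := p) (u := x') (z' := p') (h1.trans h2.symm)).infix ?_
    exact ⟨[], p', by rw [h1, nil_append]⟩
  have hyp' := hx.suffix_of_overlap h1.symm h2.symm hp hx' htri fun hpy hlt =>
    eq_of_suffix_of_overlap hlen hlt hpy hper hyp ⟨x', h1⟩ hxper hle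
  refine hconj (hx.conjugate_of_common_infix (U := x ++ x) (u := p' ++ x) hy
    (hasPeriod_of_prefix_append (by simp)) ⟨[], x, rfl⟩ hper hyp.isInfix
    ⟨x', [], by rw [append_nil, ← append_assoc, h2]⟩ (infix_refl _) ?_)
  have := hyp'.length_le
  rw [length_append]; omega

theorem Primitive.reverse {y : List α} (hy : Primitive y) : Primitive y.reverse := by
  refine ⟨by simpa using hy.1, fun v k hv h => hy.2 v.reverse k (by simpa using hv) ?_⟩
  rw [← reverse_inj, ← h]
  simp [reverse_flatten]

theorem Conjugate.reverse {x y : List α} (h : Conjugate x y) : Conjugate x.reverse y.reverse := by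
  obtain ⟨r, q, rfl, rfl⟩ := h
  exact ⟨q.reverse, r.reverse, by simp, by simp⟩

theorem reverse_wordPow (y : List α) (n : ℕ) : (wordPow y n).reverse = wordPow y.reverse n := by
  simp [wordPow, reverse_flatten]

/-- The mirror image of `append_power_ne`. -/
theorem power_append_ne {x y p s : List α} {n : ℕ} (hx : Primitive x)
    (hy : Primitive y) (hconj : ¬ Conjugate x y) (hle : y.length ≤ x.length)
    (hs : s ≠ []) (hsx : s <:+ x) (hsne : s ≠ x) (htri : s <+: x ∨ s <+: y ∨ y <+: s) :
    p ++ (x ++ x) ++ s ≠ wordPow y n ++ x := by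
  intro h
  refine append_power_ne (p := s.reverse) (s := p.reverse) (n := n) hx.reverse hy.reverse ?_
    (by simpa using hle) (by simpa using hs) (reverse_prefix.2 hsx) (by simpa using hsne) ?_ ?_
  · intro hc
    exact hconj (by simpa using hc.reverse)
  · simpa only [reverse_suffix] using htri
  · simpa only [reverse_append, reverse_wordPow, append_assoc] using congrArg List.reverse h

/-- The word `x y ^ k x` with `k ≥ 2` admits no disjoint extendable overlap with `x x`. Here
`p`, `p'` and `s`, `s'` are the overlap words of `x` with itself, on the left and on the right. -/
theorem false_of_overlap_of_two_le {x y p p' s s' x' x'' : List α} {k : ℕ} (hx : Primitive x)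
    (hy : Primitive y) (hconj : ¬ Conjugate x y) (hle : y.length ≤ x.length)
    (h1 : x = p ++ x') (h2 : x = x' ++ p') (h3 : x = s' ++ x'') (h4 : x = x'' ++ s)
    (hp : p ≠ []) (hx' : x' ≠ []) (hs : s ≠ []) (hx'' : x'' ≠ [])
    (hpow : p' ++ s' = wordPow y k) (hk : 2 ≤ k)
    (htrip : p <:+ x ∨ p <:+ y ∨ y <:+ p) (htris : s <+: x ∨ s <+: y ∨ y <+: s) : False := by
  have hyl := hy.length_pos
  have hpl := length_pos_iff.2 hp
  have hsl := length_pos_iff.2 hs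
  have hl1 := congrArg length h1
  have hl2 := congrArg length h2
  have hl3 := congrArg length h3
  have hl4 := congrArg length h4
  have hlk := congrArg length hpow
  have hk2 := Nat.mul_le_mul_right y.length hk
  rw [length_wordPow] at hlk
  simp only [length_append] at hl1 hl2 hl3 hl4 hlk
  have hpx : p ++ x = x ++ p' := by
    conv_lhs => rw [h2]
    conv_rhs => rw [h1]
    simp
  have hsx : s' ++ x = x ++ s := by
    conv_lhs => rw [h4]
    conv_rhs => rw [h3]
    simp
  have hP := hasPeriod_of_append_eq hpx
  have hS := hasPeriod_of_append_eq hsx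
  have hs's : s'.length = s.length := by omega
  rw [hs's] at hS
  have hper := hasPeriod_wordPow y k
  rw [← hpow] at hper
  have hypre : y <+: p' ++ s' := hpow ▸ prefix_wordPow y (by omega)
  have hysuf : y <:+ p' ++ s' := hpow ▸ suffix_wordPow y (by omega)
  -- neither `p` nor `s` is shorter than `y`
  have hyp : y <:+ p := by
    refine hx.suffix_of_overlap h1 h2 hp hx' htrip fun hpy hlt => ?_
    refine eq_of_suffix_of_overlap (q := s') (by omega) hlt hpy hper hypre ?_ ?_ (by omega)
    · exact prefix_of_prefix_length_le (l₃ := x) ⟨x', h1.symm⟩ ⟨x'', h3.symm⟩ (by omega)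
    · exact hP.infix ⟨p, x'' ++ p', by rw [h3]; simp⟩
  have hys : y <+: s := by
    refine hx.prefix_of_overlap h4 h3 hs hx'' htris fun hsy hlt => ?_
    refine eq_of_prefix_of_overlap (q := p') (by omega) hlt hsy hper hysuf ?_ ?_ (by omega)
    · exact suffix_of_suffix_length_le (l₃ := x) ⟨x'', h4.symm⟩ ⟨x', h2.symm⟩ (by omega)
    · exact hS.infix ⟨s' ++ x', s, by rw [h2]; simp⟩
  have hyp' : y <+: p' := prefix_of_prefix_length_le hypre (prefix_append _ _)
    (by have := hyp.length_le; omega)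
  have hys' : y <:+ s' := suffix_of_suffix_length_le hysuf (suffix_append _ _)
    (by have := hys.length_le; omega)
  have hypl := hyp.length_le
  have hysl := hys.length_le
  -- `p' s'` is short, as otherwise `x` and `y` are conjugate
  have hshort : p.length + s.length < x.length + y.length := by
    by_contra! hge
    refine hconj (hx.conjugate_of_common_infix (U := x ++ x) (u := p' ++ s') hy
      (hasPeriod_of_prefix_append (by simp)) ⟨[], x, rfl⟩ hper hypre.isInfix
      ⟨x', x'', ?_⟩ (infix_refl _) (by rw [length_append]; omega))
    conv_rhs => rw [h2]
    conv_rhs => arg 2; rw [← h2, h3]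
    simp
  -- the word `y x y` has both periods `|p|` and `|s|`
  set g := p.length.gcd s.length with hg
  have hgpos : 0 < g := Nat.gcd_pos_of_pos_left _ hpl
  have hyxy : HasPeriod (y ++ x ++ y) g := by
    obtain ⟨a, rfl⟩ := hyp
    obtain ⟨b, rfl⟩ := hyp'
    obtain ⟨c, rfl⟩ := hys
    obtain ⟨d, rfl⟩ := hys'
    refine HasPeriod.gcd (hP.infix ⟨a, b, by simp⟩) (hS.infix ⟨d, c, by simp⟩) ?_
    simp only [length_append] at *
    omega
  have hxg : HasPeriod x g := hyxy.infix ⟨y, y, rfl⟩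
  have hnot : ¬ HasPeriod (y ++ x ++ y) y.length := by
    intro h
    rw [append_assoc] at h
    obtain ⟨r, hr⟩ := prefix_of_hasPeriod_append h
    have hcomm : x ++ y = y ++ x := by
      rw [← append_assoc y x y] at hr
      exact append_inj_left hr (by simp; omega)
    obtain ⟨z, rfl⟩ : y <+: x :=
      prefix_of_prefix_length_le (l₃ := x ++ y) ⟨x, hcomm.symm⟩ (prefix_append _ _) hle
    have hc : z ++ y = y ++ z := by simpa using hcomm
    rcases hx.eq_nil_of_comm hc.symm with h0 | h0
    · exact hy.1 h0
    · exact hconj ⟨y, [], by simp [h0], by simp⟩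
  have key : ∀ u, u <:+: x → HasPeriod u y.length → y <:+: u → y.length + g ≤ u.length →
      False := by
    intro u hu hupy hyu hul
    have hd := hy.length_dvd_of_infix hupy hyu (infix_refl u) (hxg.infix hu) hgpos (by omega)
    exact hnot (hasPeriod_of_infix_of_dvd hyxy (hu.trans ⟨y, y, rfl⟩) hupy hd hgpos (by omega))
  have hp'g := fun h => key p' ⟨x', [], by rw [h2]; simp⟩ (hper.infix ⟨[], s', rfl⟩)
    hyp'.isInfix h
  have hs'g := fun h => key s' ⟨[], x'', by rw [h3]; simp⟩
    (hper.infix ⟨p', [], by simp⟩) hys'.isInfix h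
  -- two distinct multiples of `g` cannot both lie in `[|y|, |y| + g)`
  have hgap : ∀ a b : ℕ, g ∣ a → g ∣ b → a < b → a + g ≤ b := by
    intro a b ha hb hab
    have := Nat.le_of_dvd (by omega) (Nat.dvd_sub hb ha)
    omega
  have hps : p.length = s.length := by
    rcases lt_trichotomy p.length s.length with h | h | h
    · have := hgap _ _ (Nat.gcd_dvd_left _ _) (Nat.gcd_dvd_right _ _) h
      exact (hs'g (by omega)).elim
    · exact h
    · have := hgap _ _ (Nat.gcd_dvd_right _ _) (Nat.gcd_dvd_left _ _) h
      exact (hp'g (by omega)).elim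
  -- so `p' p` is a power of `y`, with `p` and `p'` conjugate
  obtain rfl : s' = p := append_inj_left (h3.symm.trans h1) (by omega)
  have hrot : p' ~r s' := by
    have r1 := isRotated_take_of_infix hP (z := p') ⟨s' ++ x, [], by simp⟩ (by omega)
    have r2 := isRotated_take_of_infix hP (z := s') ⟨[], x ++ p', by simp⟩ rfl
    exact r1.symm.trans r2
  have heq := hy.eq_of_isRotated_of_append_eq_wordPow hrot hpow hk
  subst heq
  rcases (h1 ▸ hx).eq_nil_of_comm (h1.symm.trans h2) with h | h
  · exact hp h
  · exact hx' h

/-- A square of a primitive word `x` can be covered only by a word `a y ^ k b`: the word `x` is not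
an inner entry of an interpretation of `x x`. -/
theorem IsInterpretation.exists_eq_cons_replicate_concat {x y p s : List α} {w : List (List α)}
    (hx : Primitive x) (hle : y.length ≤ x.length) (h : IsInterpretation {x, y} p (x ++ x) s w) :
    ∃ a b k, w = a :: (replicate k y ++ [b]) ∧ (a = x ∨ a = y) ∧ (b = x ∨ b = y) ∧
      p <+: a ∧ p ≠ a ∧ s <:+ b ∧ s ≠ b := by
  obtain ⟨hmem, hne, hcat, hph, hpn, hsl, hsn⟩ := h
  have hxl := hx.length_pos
  obtain ⟨a, w, rfl⟩ := exists_cons_of_ne_nil hne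
  have ha := hmem a (by simp)
  rcases eq_nil_or_concat w with rfl | ⟨w, b, rfl⟩
  · have hl := congrArg length hcat
    simp only [flatten_cons, flatten_nil, append_nil, length_append] at hl
    rcases ha with rfl | rfl <;> omega
  have hb := hmem b (by simp)
  simp only [List.concat_eq_append, ← cons_append, getLast_append_singleton]
    at hph hpn hsl hsn hcat
  refine ⟨a, b, w.length, ?_, ha, hb, hph, hpn, hsl, hsn⟩
  suffices hw : ∀ z ∈ w, z = y by rw [← eq_replicate_length.2 hw]; simp
  intro z hz
  rcases hmem z (by simp [hz]) with rfl | h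
  · exfalso
    obtain ⟨w₁, w₂, rfl⟩ := append_of_mem hz
    obtain ⟨a', rfl⟩ := hph
    obtain ⟨b', rfl⟩ := hsl
    have hin : (a' ++ w₁.flatten) ++ z ++ (w₂.flatten ++ b') = z ++ z := by
      simp only [flatten_append, flatten_cons, flatten_nil, append_nil, append_assoc,
        append_cancel_left_eq, cons_append] at hcat
      have h' : (z ++ z) ++ s = (a' ++ (w₁.flatten ++ (z ++ (w₂.flatten ++ b')))) ++ s := by
        simpa using hcat
      simpa using (append_cancel_right h').symm
    rcases hx.eq_nil_of_infix_square hin with h | h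
    · exact hpn (by simp_all)
    · exact hsn (by simp_all)
  · exact h

theorem IsDisjoint.ne_nil_left {p : List α} {U w : List (List α)} (h : IsDisjoint p U w) :
    p ≠ [] := by
  rintro rfl
  exact h [] [] (nil_prefix) (nil_prefix) rfl

theorem IsDisjoint.ne_nil_right {X : Set (List α)} {p s : List α} {U w : List (List α)}
    (h : IsDisjoint p U w) (hi : IsInterpretation X p U.flatten s w) : s ≠ [] := by
  rintro rfl
  exact h w U prefix_rfl prefix_rfl (by simpa using hi.concat_eq.symm)

/-- Both `c u` and `u' c` are powers of the same word of length `g`, namely the prefix of `c`. -/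
theorem eq_of_hasPeriod_of_append_append {c u u' : List α} {g : ℕ} (hcu : HasPeriod (c ++ u) g)
    (huc : HasPeriod (u' ++ c) g) (hc : c ≠ []) (hgc : g ∣ c.length) (hgu : g ∣ u.length)
    (hlen : u.length = u'.length) : u = u' := by
  obtain ⟨a, ha⟩ := hgc
  obtain ⟨i, hi⟩ := hgu
  have hcl := length_pos_iff.2 hc
  rw [mul_comm] at ha hi
  have hga : g ≤ c.length := Nat.le_of_dvd hcl ⟨a, by rw [ha, mul_comm]⟩
  have e1 := eq_wordPow_of_hasPeriod (a + i) hcu (by rw [length_append, ha, hi, Nat.add_mul])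
  have e2 := eq_wordPow_of_hasPeriod (i + a) huc
    (by rw [length_append, ha, ← hlen, hi, Nat.add_mul])
  have l1 : ((c ++ u).take g).length = g := by simp; omega
  have l2 : ((u' ++ c).take g).length = g := by simp; omega
  set z := (c ++ u).take g
  set z' := (u' ++ c).take g
  rw [wordPow_add] at e1 e2
  obtain ⟨c1, u1⟩ := append_inj e1 (by rw [length_wordPow, l1, ha])
  obtain ⟨u2, c2⟩ := append_inj e2 (by rw [length_wordPow, l2, ← hlen, hi])
  have ha0 := pos_of_ne_nil_of_eq_wordPow c1 hc
  have hz : z = z' := (prefix_of_prefix_length_le (c1 ▸ prefix_wordPow z ha0)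
    (c2 ▸ prefix_wordPow z' ha0) (by omega)).eq_of_length (by omega)
  rw [u1, u2, hz]

/-- The interpretations of `x x` of the form `x y ^ k x`. -/
theorem eq_of_append_square_eq_append_power_append {x y p s : List α} {k : ℕ} (hx : Primitive x)
    (hy : Primitive y) (hconj : ¬ Conjugate x y) (hle : y.length ≤ x.length)
    (hp : p ≠ []) (hs : s ≠ []) (hpx : p <+: x) (hpne : p ≠ x) (hsx : s <:+ x) (hsne : s ≠ x)
    (htrip : p <:+ x ∨ p <:+ y ∨ y <:+ p) (htris : s <+: x ∨ s <+: y ∨ y <+: s)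
    (h : p ++ (x ++ x) ++ s = x ++ (wordPow y k ++ x)) :
    k = 1 ∧ s ++ p = y ∧ p ++ x = x ++ s := by
  obtain ⟨x', h1⟩ := hpx
  obtain ⟨x'', h4⟩ := hsx
  have hx' : x' ≠ [] := by rintro rfl; exact hpne (by simpa using h1)
  have hx'' : x'' ≠ [] := by rintro rfl; exact hsne (by simpa using h4)
  have hpl := length_pos_iff.2 hp
  have hsl := length_pos_iff.2 hs
  have hl1 := congrArg length h1
  have hl4 := congrArg length h4
  simp only [length_append] at hl1 hl4
  -- cancelling `p` and `s` leaves `x x = x' y ^ k x''`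
  have hmid : x' ++ wordPow y k ++ x'' = x ++ x := by
    have h0 : p ++ ((x ++ x) ++ s) = p ++ ((x' ++ wordPow y k ++ x'') ++ s) := by
      rw [← append_assoc, h]
      conv_lhs => rw [← h1]
      conv_lhs => arg 2; arg 2; rw [h1, ← h4]
      simp
    exact (append_cancel_right (append_cancel_left h0)).symm
  obtain ⟨p', h2⟩ : x' <+: x := prefix_of_prefix_length_le (l₃ := x ++ x)
    ⟨wordPow y k ++ x'', by simpa using hmid⟩ (prefix_append _ _) (by omega)
  obtain ⟨s', h3⟩ : x'' <:+ x := suffix_of_suffix_length_le (l₃ := x ++ x)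
    ⟨x' ++ wordPow y k, hmid⟩ (suffix_append _ _) (by omega)
  have hl2 := congrArg length h2
  have hl3 := congrArg length h3
  simp only [length_append] at hl2 hl3
  have hpow : p' ++ s' = wordPow y k := by
    have h0 : x' ++ (wordPow y k ++ x'') = x' ++ ((p' ++ s') ++ x'') := by
      rw [← append_assoc, hmid]
      conv_lhs => rw [← h2]
      conv_lhs => arg 2; rw [h2, ← h3]
      simp
    exact (append_cancel_right (append_cancel_left h0)).symm
  have hk1 : 0 < k := pos_of_ne_nil_of_eq_wordPow hpow
    (by
    intro h0
    have := congrArg length h0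
    simp only [length_append, length_nil] at this
    omega)
  rcases Nat.lt_or_ge 1 k with hk | hk
  · exact (false_of_overlap_of_two_le hx hy hconj hle h1.symm h2.symm h3.symm h4.symm hp hx' hs hx''
      hpow hk htrip htris).elim
  obtain rfl : k = 1 := by omega
  have hpow1 : p' ++ s' = y := by simpa [wordPow] using hpow
  have hly := congrArg length hpow1
  simp only [length_append] at hly
  -- `|p| + |s| = |y|`, so `p` is a suffix and `s` a prefix of `y`
  have hpy : p <:+ y := by
    rcases htrip with h | h | h
    · exact absurd h (hx.not_suffix_of_overlap h1.symm h2.symm hp hx')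
    · exact h
    · have := h.length_le; omega
  have hsy : s <+: y := by
    rcases htris with h | h | h
    · exact absurd h (hx.not_prefix_of_overlap h4.symm h3.symm hs hx'')
    · exact h
    · have := h.length_le; omega
  obtain ⟨r, hr⟩ := hsy
  have hrp : r = p := by
    have hlr := congrArg length hr
    simp only [length_append] at hlr
    have : r <:+ p := suffix_of_suffix_length_le ⟨s, hr⟩ hpy (by omega)
    exact this.eq_of_length (by omega)
  rw [hrp] at hr
  refine ⟨rfl, hr, ?_⟩
  have h0 : (p ++ x) ++ (x ++ s) = (x ++ s) ++ (p ++ x) := by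
    simpa [wordPow, ← hr] using h
  suffices hps : p.length = s.length from append_inj_left h0 (by simp only [length_append]; omega)
  -- `x` has the periods `|p|` and `|s|`, whose sum is at most `|x|`, hence also their `gcd`
  have hxp : HasPeriod x p.length :=
    (hasPeriod_of_append_eq (h1.trans h2.symm)).infix ⟨[], p', by rw [h1, nil_append]⟩
  have hxs : HasPeriod x s.length := by
    have := (hasPeriod_of_append_eq (h3.trans h4.symm)).infix ⟨[], s, by rw [h3, nil_append]⟩
    rwa [show s'.length = s.length by omega] at this
  have hg := hxp.gcd hxs (by omega)
  have hgp := Nat.gcd_dvd_left p.length s.length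
  have hgs := Nat.gcd_dvd_right p.length s.length
  have heq : s ++ p = p' ++ s' := hr.trans hpow1.symm
  rcases lt_trichotomy p.length s.length with hlt | hlt | hlt
  · obtain ⟨c, rfl⟩ : p' <+: s := prefix_of_prefix_length_le (l₃ := p' ++ s')
      (prefix_append _ _) (heq ▸ prefix_append _ _) (by omega)
    obtain rfl : c ++ p = s' := by simpa using heq
    simp only [length_append] at *
    refine absurd (eq_of_hasPeriod_of_append_append (hg.infix ⟨[], x'', h3⟩)
      (hg.infix ⟨x'', [], by rw [append_nil, h4]⟩) (fun h => ?_) ?_ hgp (by omega))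
      (hx.ne_of_overlap h1.symm h2.symm hp hx')
    · simp [h] at hlt; omega
    · have := Nat.dvd_sub hgs hgp
      rwa [show p'.length + c.length - p.length = c.length by omega] at this
  · exact hlt
  · obtain ⟨c, rfl⟩ : s <+: p' := prefix_of_prefix_length_le (l₃ := p' ++ s')
      (heq ▸ prefix_append _ _) (prefix_append _ _) (by omega)
    obtain rfl : p = c ++ s' := by simpa using heq
    simp only [length_append] at *
    refine absurd (eq_of_hasPeriod_of_append_append (hg.infix ⟨[], x', h1⟩)
      (hg.infix ⟨x', [], by rw [append_nil, h2]⟩) (fun h => ?_) ?_ ?_ (by omega))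
      (hx.ne_of_overlap h3.symm h4.symm (fun h => ?_) hx'')
    · simp [h] at hlt; omega
    · have := Nat.dvd_sub hgp hgs
      rwa [show c.length + s'.length - s.length = c.length by omega] at this
    · exact (show s.length = s'.length by omega) ▸ hgs
    · simp [h] at hl3; omega

end CombinatoricsOnWords

open CombinatoricsOnWords List in
theorem mainTheorem4 {α : Type*} (x y : List α)
    (hcode : InformationTheory.UniquelyDecodable ({x, y} : Set (List α)))
    (hle : y.length ≤ x.length)
    (hx : CombinatoricsOnWords.Primitive x) (hy : CombinatoricsOnWords.Primitive y)
    (hconj : ¬ CombinatoricsOnWords.Conjugate x y)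
    (p s : List α) (w : List (List α))
    (hinterp : CombinatoricsOnWords.IsInterpretation {x, y} p (x ++ x) s w)
    (hdisj : CombinatoricsOnWords.IsDisjoint p [x, x] w)
    (hext : CombinatoricsOnWords.IsExtendable {x, y} p s) :
    w = [x, y, x] ∧ s ++ p = y ∧ p ++ x = x ++ s := by
  have hp := hdisj.ne_nil_left
  have hs := hdisj.ne_nil_right (X := {x, y}) (by simpa using hinterp)
  obtain ⟨a, b, k, rfl, ha, hb, hpa, hpne, hsb, hsne⟩ :=
    hinterp.exists_eq_cons_replicate_concat hx hle
  have hcat : p ++ (x ++ x) ++ s = a ++ (wordPow y k ++ b) := by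
    simpa [wordPow] using hinterp.concat_eq
  have hpx : p.length ≤ x.length := by
    have := hpa.length_le
    rcases ha with rfl | rfl <;> omega
  have hsx : s.length ≤ x.length := by
    have := hsb.length_le
    rcases hb with rfl | rfl <;> omega
  have htrip := suffix_trichotomy hpx hp hext.1
  have htris := prefix_trichotomy hsx hs hext.2
  rcases ha with rfl | rfl <;> rcases hb with rfl | rfl
  · obtain ⟨rfl, h⟩ := eq_of_append_square_eq_append_power_append hx hy hconj hle hp hs hpa hpne
      hsb hsne htrip htris hcat
    exact ⟨by simp, h⟩
  · rw [← wordPow_succ'] at hcat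
    exact (append_power_ne hx hy hconj hle hp hpa hpne htrip hcat).elim
  · rw [← append_assoc a, ← wordPow_succ] at hcat
    exact (power_append_ne hx hy hconj hle hs hsb hsne htris hcat).elim
  · rw [← wordPow_succ', ← wordPow_succ] at hcat
    exact (not_append_square_append_eq_wordPow hx hy hconj hle hcat).elim
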